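/- **Parabolic Weyl lemma.** Let $\mathbb{H}^-=\{(s,t)\in\mathbb{R}^2 : s\le 0\}$ be the closed lower half-plane, let $\Omega\subset\mathbb{H}^-$ be relatively open in $\mathbb{H}^-$, and let $\operatorname{int}\Omega$ denote the interior of $\Omega$ in $\mathbb{R}^2$. Let $u\in L^1_{loc}(\Omega)$ be real-valued, that is, integrable on a neighbourhood in $\Omega$ of each point of $\Omega$ (including the points of $\Omega$ with $s=0$). Suppose that $$\int_\Omega u\,\bigl(-\partial_s\varphi-\partial_t\partial_t\varphi\bigr)\,ds\,dt=0$$ for every $\varphi\in C_0^\infty(\operatorname{int}\Omega)$, i.e. for every smooth real function $\varphi$ on $\mathbb{R}^2$ whose support is compact and contained in $\operatorname{int}\Omega$. Then $u\in C^\infty(\Omega)$: after modification on a set of Lebesgue measure zero, $u$ is infinitely differentiable on $\Omega$ up to and including the part of $\Omega$ on the line $s=0$ (all partial derivatives on $\operatorname{int}\Omega$ extend continuously to $\Omega$). Moreover, this smooth representative satisfies $$\partial_s u-\partial_t\partial_t u=0$$ at every point of $\Omega$, where $\partial_s$ is the one-sided derivative (from $s<0$) at points with $s=0$. -/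

import Mathlib

open MeasureTheory Set
open scoped ContDiff

noncomputable section

namespace ParabolicWeyl

/-- The closed lower half plane: all `(s, t)` with `s ≤ 0` and `t` real. -/
def lowerHalfPlane : Set (ℝ × ℝ) := {p | p.1 ≤ 0}

/-- `Ω` is an open subset of the closed lower half plane, for the relative topology. -/
def IsOpenInLowerHalfPlane (Ω : Set (ℝ × ℝ)) : Prop :=
  ∃ U : Set (ℝ × ℝ), IsOpen U ∧ Ω = lowerHalfPlane ∩ U

/-- The partial derivative `∂_s f (s, t)` of a function on `D`; only the values of `f` on `D` enter.
It is the usual partial derivative at interior points of `D`, and the one-sided one (from `s < 0`)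
at the points `(0, t)` of a relatively open subset `D` of the closed lower half plane. -/
def partialS (D : Set (ℝ × ℝ)) (f : ℝ × ℝ → ℝ) (p : ℝ × ℝ) : ℝ :=
  derivWithin (fun σ : ℝ => f (σ, p.2)) {σ : ℝ | (σ, p.2) ∈ D} p.1

/-- The partial derivative `∂_t f (s, t)` of a function on `D`. -/
def partialT (D : Set (ℝ × ℝ)) (f : ℝ × ℝ → ℝ) (p : ℝ × ℝ) : ℝ :=
  derivWithin (fun τ : ℝ => f (p.1, τ)) {τ : ℝ | (p.1, τ) ∈ D} p.2

/-- Test functions on an open set `O` of the plane: smooth functions on the plane whose support is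
compact and contained in `O`. -/
structure IsTestFunction (O : Set (ℝ × ℝ)) (φ : ℝ × ℝ → ℝ) : Prop where
  smooth : ContDiff ℝ ∞ φ
  compact_support : HasCompactSupport φ
  support_subset : tsupport φ ⊆ O

end ParabolicWeyl

end

open ParabolicWeyl

/-! Regularity comes from a parametrix, and regularity up to `s = 0` from causality. The heat kernel
Γ is a fundamental solution of the heat operator, smooth off the origin and zero for `s ≤ 0`.
Cutting it off near the origin gives a compactly supported integrable E, living in `s ≥ 0`, which
the heat operator sends to δ minus a smooth compactly supported R (`exists_parametrix`).

For a test function ψ in a small ball with `s < 0`, the correlation `y ↦ ∫ E(z) ψ(y + z) dz` has its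
support moved only towards smaller `s`, so it is an admissible test function even when the ball
meets `s = 0`. The backward operator sends it to -ψ plus the correlation of R with ψ. Inserting this
in the weak equation and applying Fubini gives `u = f * R` almost everywhere there, f being u cut
off to a larger ball. This convolution is smooth on the whole plane, hence up to and across `s = 0`
(`IsWeakSolution.exists_contDiff_ae_eq`).

Integration by parts and density then give the equation for each local representative up to the
boundary, and the same density argument makes representatives agree on overlaps, so they glue. -/

namespace ParabolicWeyl
open Filter Topology Polynomial Metric

/-! ### Smoothness of the heat kernel away from the origin -/

/-- The function `√x * P(1/x) * exp (-1/x)` for `x > 0`, extended by zero. -/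
noncomputable def sqrtGlue (P : ℝ[X]) (x : ℝ) : ℝ := √x * (P.eval x⁻¹ * expNegInvGlue x)

theorem tendsto_sqrtGlue_zero (P : ℝ[X]) : Tendsto (sqrtGlue P) (𝓝 0) (𝓝 0) := by
  have h1 : Tendsto (fun x : ℝ => √x) (𝓝 0) (𝓝 0) := by
    simpa using Real.continuous_sqrt.tendsto 0
  have h2 := h1.mul (expNegInvGlue.tendsto_polynomial_inv_mul_zero P)
  rwa [mul_zero] at h2

/-- The family is closed under differentiation: the factor `P(1/x) exp(-1/x)` contributes `X² (P -
P')`, and `1/(2√x) = √x · x⁻¹/2` contributes `X P / 2`. Smoothness follows by induction over all P.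
-/
theorem hasDerivAt_sqrtGlue (P : ℝ[X]) (x : ℝ) :
    HasDerivAt (sqrtGlue P)
      (sqrtGlue (X ^ 2 * (P - derivative (R := ℝ) P) + C (1 / 2) * X * P) x) x := by
  rcases lt_trichotomy x 0 with hx | rfl | hx
  · have : sqrtGlue (X ^ 2 * (P - derivative (R := ℝ) P) + C (1 / 2) * X * P) x = 0 := by
      simp [sqrtGlue, expNegInvGlue.zero_of_nonpos hx.le]
    rw [this]
    refine (hasDerivAt_const _ 0).congr_of_eventuallyEq ?_
    filter_upwards [gt_mem_nhds hx] with y hy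
    simp [sqrtGlue, expNegInvGlue.zero_of_nonpos hy.le]
  · have h0 : ∀ Q : ℝ[X], sqrtGlue Q 0 = 0 := fun Q => by simp [sqrtGlue]
    rw [h0, hasDerivAt_iff_tendsto_slope]
    refine ((tendsto_sqrtGlue_zero (P * X)).mono_left inf_le_left).congr fun x => ?_
    simp [slope_def_field, sqrtGlue, div_eq_mul_inv]
    ring
  · have h1 := (Real.hasDerivAt_sqrt hx.ne').mul (expNegInvGlue.hasDerivAt_polynomial_eval_inv_mul P x)
    refine h1.congr_deriv ?_
    have h2 : 1 / (2 * √x) = √x * x⁻¹ / 2 := by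
      have h3 : √x * √x = x := Real.mul_self_sqrt hx.le
      have h4 : √x ≠ 0 := (Real.sqrt_pos.2 hx).ne'
      field_simp
      nlinarith
    rw [h2]
    simp [sqrtGlue]
    ring

theorem contDiff_sqrtGlue (P : ℝ[X]) : ContDiff ℝ ∞ (sqrtGlue P) := by
  apply contDiff_all_iff_nat.2 (fun m => ?_) ⊤
  induction m generalizing P with
  | zero =>
    exact contDiff_zero.2 (continuous_iff_continuousAt.2 fun x =>
      (hasDerivAt_sqrtGlue P x).continuousAt)
  | succ m ihm =>
    rw [show ((m + 1 : ℕ) : WithTop ℕ∞) = m + 1 from rfl]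
    refine contDiff_succ_iff_deriv.2
      ⟨fun x => (hasDerivAt_sqrtGlue P x).differentiableAt, by simp, ?_⟩
    rw [funext fun x => (hasDerivAt_sqrtGlue P x).deriv]
    exact ihm _

/-- The heat kernel: the fundamental solution of `∂_s - ∂_t ∂_t` supported in `s ≥ 0`. -/
noncomputable def heatKernel (p : ℝ × ℝ) : ℝ :=
  if 0 < p.1 then (√(4 * Real.pi * p.1))⁻¹ * Real.exp (-p.2 ^ 2 / (4 * p.1)) else 0

theorem heatKernel_of_nonpos {p : ℝ × ℝ} (hp : p.1 ≤ 0) : heatKernel p = 0 := by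
  simp [heatKernel, hp.not_gt]

theorem heatKernel_of_pos {p : ℝ × ℝ} (hp : 0 < p.1) :
    heatKernel p = (√(4 * Real.pi * p.1))⁻¹ * Real.exp (-p.2 ^ 2 / (4 * p.1)) := by
  simp [heatKernel, hp]

theorem heatKernel_nonneg (p : ℝ × ℝ) : 0 ≤ heatKernel p := by
  unfold heatKernel; split_ifs <;> positivity

/-- Up to the factor `1/(√π |t|)`, the kernel depends only on `x = 4s/t²`, through `x^(-1/2)
exp(-1/x)`. This gives smoothness across `s = 0` wherever `t ≠ 0`. -/
theorem heatKernel_eq_sqrtGlue {p : ℝ × ℝ} (hp : p.2 ≠ 0) :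
    heatKernel p = (√Real.pi)⁻¹ * (√(p.2 ^ 2))⁻¹ * sqrtGlue X (4 * p.1 / p.2 ^ 2) := by
  have h2 : 0 < p.2 ^ 2 := by positivity
  rcases le_or_gt p.1 0 with h | h
  · have : 4 * p.1 / p.2 ^ 2 ≤ 0 := div_nonpos_of_nonpos_of_nonneg (by linarith) h2.le
    simp [heatKernel_of_nonpos h, sqrtGlue, expNegInvGlue.zero_of_nonpos this]
  · have h3 : 0 < 4 * p.1 / p.2 ^ 2 := by positivity
    rw [heatKernel_of_pos h, sqrtGlue, expNegInvGlue, if_neg h3.not_ge]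
    have e1 : -(4 * p.1 / p.2 ^ 2)⁻¹ = -p.2 ^ 2 / (4 * p.1) := by
      rw [inv_div]; ring
    have e2 : √(4 * Real.pi * p.1) = √Real.pi * √(4 * p.1) := by
      rw [← Real.sqrt_mul Real.pi_pos.le]; ring_nf
    rw [e1, e2, Real.sqrt_div (by positivity), eval_X, inv_div]
    have h4 : √(p.2 ^ 2) * √(p.2 ^ 2) = p.2 ^ 2 := Real.mul_self_sqrt h2.le
    have h5 : √(4 * p.1) * √(4 * p.1) = 4 * p.1 := Real.mul_self_sqrt (by positivity)
    have h6 : √(p.2 ^ 2) ≠ 0 := (Real.sqrt_pos.2 h2).ne'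
    have h7 : √(4 * p.1) ≠ 0 := (Real.sqrt_pos.2 (by positivity)).ne'
    have h8 : √Real.pi ≠ 0 := (Real.sqrt_pos.2 Real.pi_pos).ne'
    generalize √(p.2 ^ 2) = a at *
    generalize √(4 * p.1) = b at *
    rw [← h4, ← h5]
    field_simp

theorem contDiffAt_heatKernel {p : ℝ × ℝ} (hp : p ≠ 0) : ContDiffAt ℝ ∞ heatKernel p := by
  by_cases h : p.2 = 0
  · have h1 : p.1 ≠ 0 := fun h1 => hp (Prod.ext h1 h)
    rcases h1.lt_or_gt with h1 | h1
    · refine (contDiffAt_const (c := (0 : ℝ))).congr_of_eventuallyEq ?_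
      filter_upwards [(isOpen_lt continuous_fst continuous_const).mem_nhds h1] with q hq
      exact heatKernel_of_nonpos (le_of_lt hq)
    · have : ContDiffAt ℝ ∞ (fun p : ℝ × ℝ =>
          (√(4 * Real.pi * p.1))⁻¹ * Real.exp (-p.2 ^ 2 / (4 * p.1))) p := by
        have hpos : 0 < 4 * Real.pi * p.1 := by positivity
        refine ContDiffAt.mul (ContDiffAt.inv (ContDiffAt.sqrt (by fun_prop) hpos.ne')
          (Real.sqrt_pos.2 hpos).ne') (ContDiffAt.exp (ContDiffAt.div (by fun_prop) (by fun_prop)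
          (by positivity)))
      refine this.congr_of_eventuallyEq ?_
      filter_upwards [(isOpen_lt continuous_const continuous_fst).mem_nhds h1] with q hq
      exact heatKernel_of_pos hq
  · have : ContDiffAt ℝ ∞ (fun p : ℝ × ℝ =>
        (√Real.pi)⁻¹ * (√(p.2 ^ 2))⁻¹ * sqrtGlue X (4 * p.1 / p.2 ^ 2)) p := by
      have h2 : 0 < p.2 ^ 2 := by positivity
      refine ContDiffAt.mul (contDiffAt_const.mul (ContDiffAt.inv (ContDiffAt.sqrt (by fun_prop)
        h2.ne') (Real.sqrt_pos.2 h2).ne')) ?_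
      exact (contDiff_sqrtGlue X).contDiffAt.comp p
        (ContDiffAt.div (by fun_prop) (by fun_prop) h2.ne')
    refine this.congr_of_eventuallyEq ?_
    filter_upwards [(isOpen_ne_fun continuous_snd continuous_const).mem_nhds h] with q hq
    exact heatKernel_eq_sqrtGlue hq

/-- Meant for g a derivative of a cutoff equal to 1 near the origin, which removes the only singular
point. -/
theorem contDiff_heatKernel_mul {g : ℝ × ℝ → ℝ} (hg : ContDiff ℝ ∞ g) (h0 : g =ᶠ[𝓝 0] 0) :
    ContDiff ℝ ∞ (fun p => heatKernel p * g p) := by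
  refine contDiff_iff_contDiffAt.2 fun p => ?_
  by_cases hp : p = 0
  · subst hp
    refine (contDiffAt_const (c := (0 : ℝ))).congr_of_eventuallyEq ?_
    filter_upwards [h0] with q hq
    simp [hq]
  · exact (contDiffAt_heatKernel hp).mul hg.contDiffAt

/-! ### Mass of the time slices and local integrability -/

theorem measurable_heatKernel : Measurable heatKernel := by
  unfold heatKernel
  refine Measurable.ite (measurableSet_lt measurable_const measurable_fst) ?_ measurable_const
  fun_prop

open ProbabilityTheory in
theorem heatKernel_eq_gaussianPDFReal {s : ℝ} (hs : 0 < s) :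
    (fun t => heatKernel (s, t)) = gaussianPDFReal 0 (2 * s).toNNReal := by
  ext t
  rw [heatKernel_of_pos (by exact hs), gaussianPDFReal, Real.coe_toNNReal _ (by positivity)]
  simp only [sub_zero]
  ring_nf

open ProbabilityTheory in
theorem integrable_heatKernel_slice (s : ℝ) : Integrable (fun t => heatKernel (s, t)) := by
  rcases le_or_gt s 0 with hs | hs
  · simp [heatKernel_of_nonpos (p := (s, _)) hs]
  · rw [heatKernel_eq_gaussianPDFReal hs]
    exact integrable_gaussianPDFReal _ _

open ProbabilityTheory in
theorem integral_heatKernel_slice (s : ℝ) :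
    ∫ t, heatKernel (s, t) = (Ioi (0 : ℝ)).indicator 1 s := by
  rcases le_or_gt s 0 with hs | hs
  · simp [heatKernel_of_nonpos (p := (s, _)) hs, hs]
  · rw [heatKernel_eq_gaussianPDFReal hs, integral_gaussianPDFReal_eq_one]
    · simp [hs]
    · simp [hs]

theorem integrableOn_heatKernel (S : ℝ) :
    IntegrableOn heatKernel (Iic S ×ˢ univ) (volume : Measure (ℝ × ℝ)) := by
  rw [IntegrableOn, Measure.volume_eq_prod, ← Measure.prod_restrict, Measure.restrict_univ,
    integrable_prod_iff measurable_heatKernel.aestronglyMeasurable]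
  refine ⟨ae_of_all _ integrable_heatKernel_slice, ?_⟩
  simp only [Real.norm_of_nonneg (heatKernel_nonneg _), integral_heatKernel_slice]
  refine (integrable_indicator_iff measurableSet_Ioi).2 ?_
  rw [IntegrableOn, Measure.restrict_restrict measurableSet_Ioi, Ioi_inter_Iic]
  exact (integrable_const 1 : Integrable (fun _ => (1 : ℝ)) (volume.restrict (Ioc 0 S)))

theorem locallyIntegrable_heatKernel : LocallyIntegrable heatKernel := by
  intro p
  refine ⟨Iic (p.1 + 1) ×ˢ univ, prod_mem_nhds (Iic_mem_nhds (by linarith)) univ_mem, ?_⟩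
  exact integrableOn_heatKernel _

/-! ### Gaussian rescaling and Stein's identity -/

/-- The standard Gaussian density, as a time slice of the heat kernel. -/
noncomputable def gaussSlice (z : ℝ) : ℝ := heatKernel (1 / 2, z)

theorem gaussSlice_eq (z : ℝ) :
    gaussSlice z = (√(2 * Real.pi))⁻¹ * Real.exp (-(1 / 2) * z ^ 2) := by
  rw [gaussSlice, heatKernel_of_pos (by norm_num)]
  ring_nf

theorem integrable_gaussSlice : Integrable gaussSlice := integrable_heatKernel_slice _

theorem integral_gaussSlice : ∫ z, gaussSlice z = 1 := by
  simp [gaussSlice, integral_heatKernel_slice]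

theorem gaussSlice_nonneg (z : ℝ) : 0 ≤ gaussSlice z := heatKernel_nonneg _

theorem integrable_mul_gaussSlice : Integrable (fun z => z * gaussSlice z) := by
  have := (integrable_mul_exp_neg_mul_sq (b := 1 / 2) (by norm_num)).const_mul (√(2 * Real.pi))⁻¹
  refine this.congr (ae_of_all _ fun z => ?_)
  simp only [gaussSlice_eq]
  ring

theorem hasDerivAt_gaussSlice (z : ℝ) : HasDerivAt gaussSlice (-(z * gaussSlice z)) z := by
  have h : HasDerivAt (fun z : ℝ => (√(2 * Real.pi))⁻¹ * Real.exp (-(1 / 2) * z ^ 2))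
      ((√(2 * Real.pi))⁻¹ * (Real.exp (-(1 / 2) * z ^ 2) * (-(1 / 2) * (2 * z)))) z := by
    refine HasDerivAt.const_mul _ (HasDerivAt.exp (HasDerivAt.const_mul _ ?_))
    simpa using hasDerivAt_pow 2 z
  rw [funext gaussSlice_eq]
  refine h.congr_deriv ?_
  ring

theorem continuous_gaussSlice : Continuous gaussSlice :=
  continuous_iff_continuousAt.2 fun z => (hasDerivAt_gaussSlice z).continuousAt

/-- The substitution `t = √(2s) z` turns every slice into one fixed Gaussian. Then `s` enters only
through the argument of g, which allows differentiation in `s` and the limit `s → 0`. -/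
theorem integral_heatKernel_slice_mul {s : ℝ} (hs : 0 < s) (g : ℝ → ℝ) :
    ∫ t, heatKernel (s, t) * g t = ∫ z, gaussSlice z * g (√(2 * s) * z) := by
  have ha : 0 < √(2 * s) := Real.sqrt_pos.2 (by positivity)
  have key : ∀ z, gaussSlice z = √(2 * s) * heatKernel (s, √(2 * s) * z) := by
    intro z
    rw [gaussSlice_eq, heatKernel_of_pos (by exact hs), mul_pow, Real.sq_sqrt (by positivity)]
    have e1 : √(4 * Real.pi * s) = √(2 * Real.pi) * √(2 * s) := by
      rw [← Real.sqrt_mul (by positivity)]; ring_nf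
    have e2 : -(2 * s * z ^ 2) / (4 * s) = -(1 / 2) * z ^ 2 := by field_simp; ring
    have e3 : √(2 * Real.pi) ≠ 0 := (Real.sqrt_pos.2 (by positivity)).ne'
    simp only [e1, e2]
    field_simp
  have := Measure.integral_comp_mul_left (fun t => heatKernel (s, t) * g t) (√(2 * s))
  rw [abs_of_pos (inv_pos.2 ha), smul_eq_mul, eq_inv_mul_iff_mul_eq₀ ha.ne',
    ← integral_const_mul] at this
  rw [← this]
  refine integral_congr_ae (ae_of_all _ fun z => ?_)
  simp only [key z]
  ring

/-- Stein's identity. -/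
theorem integral_gaussSlice_stein {f f' : ℝ → ℝ} (hf : ∀ z, HasDerivAt f (f' z) z)
    (hf'c : Continuous f') {C : ℝ} (hC : ∀ z, |f z| ≤ C) (hC' : ∀ z, |f' z| ≤ C) :
    ∫ z, z * gaussSlice z * f z = ∫ z, gaussSlice z * f' z := by
  have hfc : Continuous f := continuous_iff_continuousAt.2 fun z => (hf z).continuousAt
  have h1 : Integrable (fun z => gaussSlice z * f' z) :=
    integrable_gaussSlice.mul_bdd hf'c.aestronglyMeasurable (ae_of_all _ hC')
  have h2 : Integrable (fun z => z * gaussSlice z * f z) :=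
    integrable_mul_gaussSlice.mul_bdd hfc.aestronglyMeasurable (ae_of_all _ hC)
  have h3 : Integrable (fun z => gaussSlice z * f z) :=
    integrable_gaussSlice.mul_bdd hfc.aestronglyMeasurable (ae_of_all _ hC)
  have := integral_mul_deriv_eq_deriv_mul_of_integrable (u := gaussSlice)
    (u' := fun z => -(z * gaussSlice z)) (v := f) (v' := f')
    (fun z _ => hasDerivAt_gaussSlice z) (fun z _ => hf z) h1
    (h2.neg.congr (ae_of_all _ fun z => by simp)) h3
  rw [this, ← integral_neg]
  refine integral_congr_ae (ae_of_all _ fun z => ?_)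
  simp

/-! ### Directional derivatives -/

/-- The directional derivative `p ↦ f'(p) d`. -/
noncomputable def dirDeriv (d : ℝ × ℝ) (f : ℝ × ℝ → ℝ) (p : ℝ × ℝ) : ℝ := fderiv ℝ f p d

section dirDeriv
variable {d : ℝ × ℝ} {f g : ℝ × ℝ → ℝ}

theorem contDiff_dirDeriv (hf : ContDiff ℝ ∞ f) : ContDiff ℝ ∞ (dirDeriv d f) :=
  (hf.fderiv_right (m := ∞) (by simp)).clm_apply contDiff_const

theorem tsupport_dirDeriv_subset : tsupport (dirDeriv d f) ⊆ tsupport f :=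
  tsupport_fderiv_apply_subset ℝ d

theorem hasCompactSupport_dirDeriv (hf : HasCompactSupport f) :
    HasCompactSupport (dirDeriv d f) := hf.fderiv_apply ℝ d

theorem dirDeriv_mul (hf : ContDiff ℝ ∞ f) (hg : ContDiff ℝ ∞ g) (p : ℝ × ℝ) :
    dirDeriv d (fun q => f q * g q) p = dirDeriv d f p * g p + f p * dirDeriv d g p := by
  have := fderiv_fun_mul (hf.differentiable (by simp) p) (hg.differentiable (by simp) p)
  simp only [dirDeriv, this]
  simp
  ring

theorem hasDerivAt_dirDeriv (hf : ContDiff ℝ ∞ f) {c : ℝ → ℝ × ℝ} {c' : ℝ × ℝ} {x : ℝ}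
    (hc : HasDerivAt c c' x) : HasDerivAt (fun y => f (c y)) (dirDeriv c' f (c x)) x :=
  (hf.differentiable (by simp) (c x)).hasFDerivAt.comp_hasDerivAt x hc

end dirDeriv

theorem exists_bound_of_hasCompactSupport {f : ℝ × ℝ → ℝ} (hf : Continuous f)
    (hc : HasCompactSupport f) : ∃ C, 0 ≤ C ∧ ∀ p, |f p| ≤ C := by
  obtain ⟨C, hC⟩ := hf.bounded_above_of_compact_support hc
  exact ⟨C, (norm_nonneg _).trans (hC 0), hC⟩

theorem dirDeriv_eq_add (f : ℝ × ℝ → ℝ) (p : ℝ × ℝ) (a b : ℝ) :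
    dirDeriv (a, b) f p = a * dirDeriv (1, 0) f p + b * dirDeriv (0, 1) f p := by
  have : ((a, b) : ℝ × ℝ) = a • (1, 0) + b • (0, 1) := by simp
  rw [dirDeriv, this, map_add, map_smul, map_smul]
  rfl

/-! ### The fundamental solution property -/

theorem integrable_heatKernel_mul {g : ℝ × ℝ → ℝ} (hg : Continuous g) (hc : HasCompactSupport g) :
    Integrable (fun p => heatKernel p * g p) := by
  simpa [mul_comm] using locallyIntegrable_heatKernel.integrable_smul_left_of_hasCompactSupport hg hc

/-- The chain rule produces `ψ_s + (z/√(2s)) ψ_t`. Stein's identity trades the factor z for a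
z-derivative, that is `√(2s) ψ_tt`, and the square roots cancel. -/
theorem hasDerivAt_gaussSlice_average {ψ : ℝ × ℝ → ℝ} (hψ : ContDiff ℝ ∞ ψ)
    (hc : HasCompactSupport ψ) {s : ℝ} (hs : 0 < s) :
    HasDerivAt (fun s => ∫ z, gaussSlice z * ψ (s, √(2 * s) * z))
      (∫ t, heatKernel (s, t) * (dirDeriv (1, 0) ψ (s, t) +
        dirDeriv (0, 1) (dirDeriv (0, 1) ψ) (s, t))) s := by
  have hψs := contDiff_dirDeriv (d := (1, 0)) hψ
  have hψt := contDiff_dirDeriv (d := (0, 1)) hψ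
  have hψtt := contDiff_dirDeriv (d := (0, 1)) hψt
  obtain ⟨C, hC0, hC⟩ := exists_bound_of_hasCompactSupport hψ.continuous hc
  obtain ⟨Cs, hCs0, hCs⟩ := exists_bound_of_hasCompactSupport hψs.continuous
    (hasCompactSupport_dirDeriv hc)
  obtain ⟨Ct, hCt0, hCt⟩ := exists_bound_of_hasCompactSupport hψt.continuous
    (hasCompactSupport_dirDeriv hc)
  obtain ⟨Ctt, hCtt0, hCtt⟩ := exists_bound_of_hasCompactSupport hψtt.continuous
    (hasCompactSupport_dirDeriv (hasCompactSupport_dirDeriv hc))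
  have hcurve : ∀ σ : ℝ, 0 < σ → ∀ z : ℝ,
      HasDerivAt (fun σ : ℝ => ((σ, √(2 * σ) * z) : ℝ × ℝ)) (1, 1 / √(2 * σ) * z) σ := by
    intro σ hσ z
    refine (hasDerivAt_id σ).prodMk (HasDerivAt.mul_const ?_ z)
    have h1 : HasDerivAt (fun σ : ℝ => 2 * σ) 2 σ := by
      simpa using (hasDerivAt_id σ).const_mul 2
    refine (h1.sqrt (by positivity)).congr_deriv ?_
    ring
  have hmeas : ∀ (σ : ℝ) {g : ℝ × ℝ → ℝ}, ContDiff ℝ ∞ g →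
      Continuous (fun z : ℝ => g (σ, √(2 * σ) * z)) := by
    intro σ g hg
    exact hg.continuous.comp (by fun_prop)
  have hint : ∀ (σ : ℝ) {g : ℝ × ℝ → ℝ} {B : ℝ}, ContDiff ℝ ∞ g → (∀ p, |g p| ≤ B) →
      Integrable (fun z : ℝ => gaussSlice z * g (σ, √(2 * σ) * z)) := by
    intro σ g B hg hB
    exact integrable_gaussSlice.mul_bdd (hmeas σ hg).aestronglyMeasurable (ae_of_all _ fun z => hB _)
  have main := hasDerivAt_integral_of_dominated_loc_of_deriv_le (μ := volume)
    (F := fun σ z => gaussSlice z * ψ (σ, √(2 * σ) * z))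
    (F' := fun σ z => gaussSlice z * (dirDeriv (1, 0) ψ (σ, √(2 * σ) * z) +
      1 / √(2 * σ) * z * dirDeriv (0, 1) ψ (σ, √(2 * σ) * z)))
    -- On `σ > s/2` one has `2σ > s`, so `1/√(2σ) ≤ 1/√s` uniformly in σ.
    (bound := fun z => Cs * gaussSlice z + 1 / √s * Ct * |z * gaussSlice z|)
    (s := Ioi (s / 2)) (x₀ := s) (Ioi_mem_nhds (by linarith))
    (Eventually.of_forall fun σ => (hint σ hψ hC).aestronglyMeasurable)
    (hint s hψ hC) ?_ ?_ ?_ ?_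
  · refine main.2.congr_deriv ?_
    rw [integral_heatKernel_slice_mul hs (fun t => dirDeriv (1, 0) ψ (s, t) +
        dirDeriv (0, 1) (dirDeriv (0, 1) ψ) (s, t))]
    have ha : √(2 * s) ≠ 0 := (Real.sqrt_pos.2 (by positivity)).ne'
    have stein := integral_gaussSlice_stein (f := fun z => dirDeriv (0, 1) ψ (s, √(2 * s) * z))
      (f' := fun z => √(2 * s) * dirDeriv (0, 1) (dirDeriv (0, 1) ψ) (s, √(2 * s) * z))
      (C := Ct + √(2 * s) * Ctt) ?_ ((hmeas s hψtt).const_mul _)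
      (fun z => (hCt _).trans (le_add_of_nonneg_right (by positivity)))
      (fun z => ?_)
    · have e1 : ∫ z, gaussSlice z * (dirDeriv (1, 0) ψ (s, √(2 * s) * z) +
          1 / √(2 * s) * z * dirDeriv (0, 1) ψ (s, √(2 * s) * z)) =
          (∫ z, gaussSlice z * dirDeriv (1, 0) ψ (s, √(2 * s) * z)) +
          1 / √(2 * s) * ∫ z, z * gaussSlice z * dirDeriv (0, 1) ψ (s, √(2 * s) * z) := by
        rw [← integral_const_mul, ← integral_add (hint s hψs hCs)
          ((integrable_mul_gaussSlice.mul_bdd (hmeas s hψt).aestronglyMeasurable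
            (ae_of_all _ fun z => hCt _)).const_mul _)]
        exact integral_congr_ae (ae_of_all _ fun z => by ring)
      rw [e1, stein, ← integral_const_mul, ← integral_add (hint s hψs hCs)]
      · refine integral_congr_ae (ae_of_all _ fun z => ?_)
        simp only
        field_simp
      · refine (hint s hψtt hCtt).congr (ae_of_all _ fun z => ?_)
        simp only
        field_simp
    · intro z
      have h1 : HasDerivAt (fun z : ℝ => ((s, √(2 * s) * z) : ℝ × ℝ)) (0, √(2 * s)) z :=
        (hasDerivAt_const z s).prodMk (by simpa using (hasDerivAt_id z).const_mul (√(2 * s)))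
      refine (hasDerivAt_dirDeriv hψt h1).congr_deriv ?_
      rw [dirDeriv_eq_add]
      ring
    · rw [abs_mul, abs_of_nonneg (Real.sqrt_nonneg _)]
      have := mul_le_mul_of_nonneg_left (hCtt (s, √(2 * s) * z)) (Real.sqrt_nonneg (2 * s))
      linarith
  · refine (continuous_gaussSlice.mul ((hmeas s hψs).add
      ((continuous_const.mul continuous_id).mul (hmeas s hψt)))).aestronglyMeasurable
  · refine ae_of_all _ fun z σ hσ => ?_
    have hσ' : s / 2 < σ := hσ
    have h1 : √s ≤ √(2 * σ) := Real.sqrt_le_sqrt (by linarith)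
    have h0 : 0 < √s := Real.sqrt_pos.2 hs
    have h2 : 1 / √(2 * σ) ≤ 1 / √s := one_div_le_one_div_of_le h0 h1
    rw [Real.norm_eq_abs, abs_mul, abs_of_nonneg (gaussSlice_nonneg z), abs_mul,
      abs_of_nonneg (gaussSlice_nonneg z)]
    have h3 : |1 / √(2 * σ) * z * dirDeriv (0, 1) ψ (σ, √(2 * σ) * z)| ≤ 1 / √s * |z| * Ct := by
      rw [abs_mul, abs_mul, abs_of_nonneg (by positivity : 0 ≤ 1 / √(2 * σ))]
      gcongr
      exact hCt _
    calc gaussSlice z * |dirDeriv (1, 0) ψ (σ, √(2 * σ) * z) +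
          1 / √(2 * σ) * z * dirDeriv (0, 1) ψ (σ, √(2 * σ) * z)|
        ≤ gaussSlice z * (Cs + 1 / √s * |z| * Ct) :=
          mul_le_mul_of_nonneg_left ((abs_add_le _ _).trans (add_le_add (hCs _) h3))
            (gaussSlice_nonneg z)
      _ = _ := by ring
  · exact (integrable_gaussSlice.const_mul _).add (integrable_mul_gaussSlice.abs.const_mul _)
  · refine ae_of_all _ fun z σ hσ => ?_
    have hσ' : s / 2 < σ := hσ
    refine ((hasDerivAt_dirDeriv hψ (hcurve σ (by linarith) z)).const_mul _).congr_deriv ?_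
    rw [dirDeriv_eq_add]
    ring

/-- The heat kernel is a fundamental solution. -/
theorem integral_heatKernel_mul {ψ : ℝ × ℝ → ℝ} (hψ : ContDiff ℝ ∞ ψ)
    (hc : HasCompactSupport ψ) :
    ∫ p, heatKernel p * (dirDeriv (1, 0) ψ p + dirDeriv (0, 1) (dirDeriv (0, 1) ψ) p) = -ψ 0 := by
  have hψs := contDiff_dirDeriv (d := (1, 0)) hψ
  have hψtt := contDiff_dirDeriv (d := (0, 1)) (contDiff_dirDeriv (d := (0, 1)) hψ)
  have hcs := hasCompactSupport_dirDeriv (d := (1, 0)) hc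
  have hctt := hasCompactSupport_dirDeriv (d := (0, 1)) (hasCompactSupport_dirDeriv (d := (0, 1)) hc)
  have hint := integrable_heatKernel_mul (hψs.continuous.add hψtt.continuous) (hcs.add hctt)
  simp only [Pi.add_apply] at hint
  have hint' := hint
  rw [Measure.volume_eq_prod] at hint' ⊢
  rw [integral_prod _ hint']
  rw [← setIntegral_eq_integral_of_forall_compl_eq_zero (s := Ioi 0)]
  -- The slice integral is an exact `s`-derivative. The rescaled average extends continuously to `s
  -- = 0` with value `ψ 0`, and vanishes for large `s` by compact support.
  · rw [integral_Ioi_of_hasDerivAt_of_tendsto (m := 0) ?_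
      (fun s hs => hasDerivAt_gaussSlice_average hψ hc hs) hint'.integral_prod_left.integrableOn ?_]
    · simp only [mul_zero, Real.sqrt_zero, zero_mul, integral_mul_const, integral_gaussSlice]
      simp [Prod.zero_eq_mk]
    · obtain ⟨C, hC0, hC⟩ := exists_bound_of_hasCompactSupport hψ.continuous hc
      refine (continuous_of_dominated (bound := fun z => gaussSlice z * C) ?_ ?_ ?_ ?_).continuousWithinAt
      · intro s
        exact (continuous_gaussSlice.mul (hψ.continuous.comp (by fun_prop))).aestronglyMeasurable
      · intro s
        refine ae_of_all _ fun z => ?_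
        rw [Real.norm_eq_abs, abs_mul, abs_of_nonneg (gaussSlice_nonneg z)]
        exact mul_le_mul_of_nonneg_left (hC _) (gaussSlice_nonneg z)
      · exact integrable_gaussSlice.mul_const _
      · refine ae_of_all _ fun z => ?_
        exact continuous_const.mul (hψ.continuous.comp (by fun_prop))
    · refine (tendsto_const_nhds (x := (0 : ℝ))).congr' ?_
      obtain ⟨R, hR⟩ := hc.isCompact.isBounded.subset_closedBall 0
      filter_upwards [eventually_gt_atTop R, eventually_ge_atTop 0] with s hs hs0
      have : ∀ t, ψ (s, t) = 0 := by
        intro t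
        refine image_eq_zero_of_notMem_tsupport fun h => ?_
        have h1 := hR h
        rw [mem_closedBall_zero_iff] at h1
        have h2 := (norm_fst_le ((s, t) : ℝ × ℝ)).trans h1
        simp only [Real.norm_eq_abs, abs_of_nonneg hs0] at h2
        linarith
      simp [this]
  · intro s hs
    have : ∀ t, heatKernel (s, t) = 0 := fun t => heatKernel_of_nonpos (by simpa using hs)
    simp [this]

/-! ### The heat operator and its adjoint -/

/-- The backward heat operator `∂_s + ∂_t ∂_t`. -/
noncomputable def backwardHeat (f : ℝ × ℝ → ℝ) (p : ℝ × ℝ) : ℝ :=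
  dirDeriv (1, 0) f p + dirDeriv (0, 1) (dirDeriv (0, 1) f) p

/-- The heat operator `∂_s - ∂_t ∂_t`. -/
noncomputable def heatOp (f : ℝ × ℝ → ℝ) (p : ℝ × ℝ) : ℝ :=
  dirDeriv (1, 0) f p - dirDeriv (0, 1) (dirDeriv (0, 1) f) p

section
variable {f g : ℝ × ℝ → ℝ}

theorem contDiff_backwardHeat (hf : ContDiff ℝ ∞ f) : ContDiff ℝ ∞ (backwardHeat f) :=
  (contDiff_dirDeriv hf).add (contDiff_dirDeriv (contDiff_dirDeriv hf))

theorem contDiff_heatOp (hf : ContDiff ℝ ∞ f) : ContDiff ℝ ∞ (heatOp f) :=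
  (contDiff_dirDeriv hf).sub (contDiff_dirDeriv (contDiff_dirDeriv hf))

theorem backwardHeat_of_notMem_tsupport {p : ℝ × ℝ} (hp : p ∉ tsupport f) :
    backwardHeat f p = 0 := by
  have h : ∀ d, dirDeriv d f p = 0 := fun d =>
    image_eq_zero_of_notMem_tsupport fun h => hp (tsupport_dirDeriv_subset h)
  have h' : dirDeriv (0, 1) (dirDeriv (0, 1) f) p = 0 :=
    image_eq_zero_of_notMem_tsupport fun h =>
      hp (tsupport_dirDeriv_subset (tsupport_dirDeriv_subset h))
  simp [backwardHeat, h, h']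

theorem hasCompactSupport_backwardHeat (hf : HasCompactSupport f) :
    HasCompactSupport (backwardHeat f) :=
  (hasCompactSupport_dirDeriv hf).add (hasCompactSupport_dirDeriv (hasCompactSupport_dirDeriv hf))

theorem backwardHeat_mul (hf : ContDiff ℝ ∞ f) (hg : ContDiff ℝ ∞ g) (p : ℝ × ℝ) :
    backwardHeat (fun q => f q * g q) p = f p * backwardHeat g p + backwardHeat f p * g p +
      2 * dirDeriv (0, 1) f p * dirDeriv (0, 1) g p := by
  have hft := contDiff_dirDeriv (d := (0, 1)) hf
  have hgt := contDiff_dirDeriv (d := (0, 1)) hg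
  have e : dirDeriv (0, 1) (fun q => f q * g q) =
      fun q => dirDeriv (0, 1) f q * g q + f q * dirDeriv (0, 1) g q :=
    funext fun q => dirDeriv_mul hf hg q
  have e2 : dirDeriv (0, 1) (fun q => dirDeriv (0, 1) f q * g q + f q * dirDeriv (0, 1) g q) p =
      dirDeriv (0, 1) (fun q => dirDeriv (0, 1) f q * g q) p +
      dirDeriv (0, 1) (fun q => f q * dirDeriv (0, 1) g q) p := by
    have := fderiv_fun_add ((hft.mul hg).differentiable (by simp) p)
      ((hf.mul hgt).differentiable (by simp) p)
    exact congrArg (fun L => L (0, 1)) this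
  rw [backwardHeat, e, e2, dirDeriv_mul hf hg, dirDeriv_mul hft hg, dirDeriv_mul hf hgt,
    backwardHeat, backwardHeat]
  ring

theorem integral_mul_dirDeriv {d : ℝ × ℝ} (hf : ContDiff ℝ ∞ f) (hg : ContDiff ℝ ∞ g)
    (hc : HasCompactSupport g) :
    ∫ p, f p * dirDeriv d g p = -∫ p, dirDeriv d f p * g p := by
  refine integral_mul_fderiv_eq_neg_fderiv_mul_of_integrable ?_ ?_ ?_
    (fun x _ => hf.differentiable (by simp) x) (fun x _ => hg.differentiable (by simp) x)
  · exact ((contDiff_dirDeriv hf).continuous.mul hg.continuous).integrable_of_hasCompactSupport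
      hc.mul_left
  · exact (hf.continuous.mul (contDiff_dirDeriv hg).continuous).integrable_of_hasCompactSupport
      (hasCompactSupport_dirDeriv hc).mul_left
  · exact (hf.continuous.mul hg.continuous).integrable_of_hasCompactSupport hc.mul_left

theorem integral_mul_backwardHeat (hf : ContDiff ℝ ∞ f) (hg : ContDiff ℝ ∞ g)
    (hc : HasCompactSupport g) :
    ∫ p, f p * backwardHeat g p = -∫ p, heatOp f p * g p := by
  have hgt := contDiff_dirDeriv (d := (0, 1)) hg
  have hct := hasCompactSupport_dirDeriv (d := (0, 1)) hc
  have hft := contDiff_dirDeriv (d := (0, 1)) hf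
  have i : ∀ {a b : ℝ × ℝ → ℝ}, ContDiff ℝ ∞ a → ContDiff ℝ ∞ b → HasCompactSupport b →
      Integrable (fun p => a p * b p) := fun ha hb hcb =>
    (ha.continuous.mul hb.continuous).integrable_of_hasCompactSupport hcb.mul_left
  simp only [backwardHeat, heatOp, mul_add, sub_mul]
  rw [integral_add (i hf (contDiff_dirDeriv hg) (hasCompactSupport_dirDeriv hc))
      (i hf (contDiff_dirDeriv hgt) (hasCompactSupport_dirDeriv hct)),
    integral_sub (i (contDiff_dirDeriv hf) hg hc) (i (contDiff_dirDeriv hft) hg hc),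
    integral_mul_dirDeriv hf hg hc, integral_mul_dirDeriv hf hgt hct,
    integral_mul_dirDeriv hft hg hc]
  ring

theorem dirDeriv_comp_add_left (d y p : ℝ × ℝ) :
    dirDeriv d (fun q => f (y + q)) p = dirDeriv d f (y + p) := by
  rw [dirDeriv, fderiv_comp_add_left, dirDeriv]

theorem backwardHeat_comp_add_left (y p : ℝ × ℝ) :
    backwardHeat (fun q => f (y + q)) p = backwardHeat f (y + p) := by
  have e : dirDeriv (0, 1) (fun q => f (y + q)) = fun q => dirDeriv (0, 1) f (y + q) :=
    funext fun q => dirDeriv_comp_add_left _ _ _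
  rw [backwardHeat, e, dirDeriv_comp_add_left, dirDeriv_comp_add_left, backwardHeat]

end

/-! ### The parametrix -/

/-- A compactly supported parametrix of the heat operator, with smooth error term. -/
theorem exists_parametrix {r : ℝ} (hr : 0 < r) : ∃ E R : ℝ × ℝ → ℝ,
    Integrable E ∧ (∀ p, E p ≠ 0 → p ∈ closedBall (0 : ℝ × ℝ) r ∩ {p | 0 ≤ p.1}) ∧
    ContDiff ℝ ∞ R ∧ HasCompactSupport R ∧
    ∀ ψ : ℝ × ℝ → ℝ, ContDiff ℝ ∞ ψ → HasCompactSupport ψ →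
      ∫ p, E p * backwardHeat ψ p = -ψ 0 + ∫ p, R p * ψ p := by
  let b : ContDiffBump (0 : ℝ × ℝ) := ⟨r / 2, r, by linarith, by linarith⟩
  obtain ⟨χ, hχ⟩ : ∃ χ : ℝ × ℝ → ℝ, χ = b := ⟨_, rfl⟩
  have hs : ContDiff ℝ ∞ χ := hχ ▸ b.contDiff
  have hc : HasCompactSupport χ := hχ ▸ b.hasCompactSupport
  have h1 : χ =ᶠ[𝓝 0] 1 := hχ ▸ b.eventuallyEq_one
  have hsupp : ∀ p, χ p ≠ 0 → p ∈ closedBall (0 : ℝ × ℝ) r := by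
    intro p hp
    have : p ∈ Function.support b := by rw [← hχ]; exact hp
    rw [b.support_eq] at this
    exact ball_subset_closedBall this
  have hd : ∀ d, dirDeriv d χ =ᶠ[𝓝 0] 0 := by
    intro d
    filter_upwards [h1.fderiv (𝕜 := ℝ)] with q hq
    simp only [dirDeriv, hq]
    simp [show (1 : ℝ × ℝ → ℝ) = fun _ => 1 from rfl]
  have hdt : dirDeriv (0, 1) (dirDeriv (0, 1) χ) =ᶠ[𝓝 0] 0 := by
    filter_upwards [(hd (0, 1)).fderiv (𝕜 := ℝ)] with q hq
    simp only [dirDeriv] at hq ⊢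
    rw [hq]
    simp [show (0 : ℝ × ℝ → ℝ) = fun _ => 0 from rfl]
  have hb : backwardHeat χ =ᶠ[𝓝 0] 0 := by
    filter_upwards [hd (1, 0), hdt] with q hq hq'
    simp [backwardHeat, hq, hq']
  have hχt := contDiff_dirDeriv (d := (0, 1)) hs
  have hχtc := hasCompactSupport_dirDeriv (d := (0, 1)) hc
  have hA := contDiff_heatKernel_mul hχt (hd _)
  have hAc : HasCompactSupport (fun p => heatKernel p * dirDeriv (0, 1) χ p) := hχtc.mul_left
  have hB := contDiff_heatKernel_mul (contDiff_backwardHeat hs) hb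
  have hBc : HasCompactSupport (fun p => heatKernel p * backwardHeat χ p) :=
    (hasCompactSupport_backwardHeat hc).mul_left
  -- Apply the fundamental solution identity to χψ and expand by Leibniz. The cross term `2 Γ χ_t
  -- ψ_t` is integrated by parts to free ψ of derivatives. Every term of the error carries a
  -- derivative of χ, hence is smooth.
  refine ⟨fun p => heatKernel p * χ p, fun p =>
    2 * dirDeriv (0, 1) (fun p => heatKernel p * dirDeriv (0, 1) χ p) p -
      heatKernel p * backwardHeat χ p,
    integrable_heatKernel_mul hs.continuous hc, ?_, ?_, ?_, ?_⟩
  · intro p hp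
    refine ⟨hsupp p (right_ne_zero_of_mul hp), ?_⟩
    by_contra h
    exact left_ne_zero_of_mul hp (heatKernel_of_nonpos (not_le.1 h).le)
  · exact (contDiff_const.mul (contDiff_dirDeriv hA)).sub hB
  · exact (hasCompactSupport_dirDeriv hAc).mul_left.sub hBc
  · intro ψ hψ hψc
    have key := integral_heatKernel_mul (hs.mul hψ) (hc.mul_right (f' := ψ))
    have hψt := contDiff_dirDeriv (d := (0, 1)) hψ
    have e : ∀ p, heatKernel p * (dirDeriv (1, 0) (fun q => χ q * ψ q) p +
        dirDeriv (0, 1) (dirDeriv (0, 1) (fun q => χ q * ψ q)) p) =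
        heatKernel p * χ p * backwardHeat ψ p + (heatKernel p * backwardHeat χ p * ψ p +
        2 * (heatKernel p * dirDeriv (0, 1) χ p * dirDeriv (0, 1) ψ p)) := by
      intro p
      have := backwardHeat_mul hs hψ p
      rw [backwardHeat] at this
      rw [this]
      ring
    have i1 : Integrable (fun p => heatKernel p * χ p * backwardHeat ψ p) := by
      simp only [mul_assoc]
      exact integrable_heatKernel_mul (hs.continuous.mul (contDiff_backwardHeat hψ).continuous)
        hc.mul_right
    have i2 : Integrable (fun p => heatKernel p * backwardHeat χ p * ψ p) :=
      (hB.continuous.mul hψ.continuous).integrable_of_hasCompactSupport hψc.mul_left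
    have i3 : Integrable (fun p => 2 * (heatKernel p * dirDeriv (0, 1) χ p *
        dirDeriv (0, 1) ψ p)) :=
      ((hA.continuous.mul hψt.continuous).integrable_of_hasCompactSupport
        (hasCompactSupport_dirDeriv hψc).mul_left).const_mul 2
    have i4 : Integrable (fun p =>
        2 * (dirDeriv (0, 1) (fun p => heatKernel p * dirDeriv (0, 1) χ p) p * ψ p)) :=
      (((contDiff_dirDeriv hA).continuous.mul hψ.continuous).integrable_of_hasCompactSupport
        hψc.mul_left).const_mul 2
    have i23 : Integrable (fun p => heatKernel p * backwardHeat χ p * ψ p +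
        2 * (heatKernel p * dirDeriv (0, 1) χ p * dirDeriv (0, 1) ψ p)) := i2.add i3
    have h10 : χ 0 = 1 := h1.eq_of_nhds
    rw [integral_congr_ae (ae_of_all _ e), integral_add i1 i23, integral_add i2 i3,
      integral_const_mul, integral_mul_dirDeriv hA hψ hψc, h10, one_mul] at key
    simp only [sub_mul, mul_assoc (2 : ℝ)]
    rw [integral_sub i4 i2, integral_const_mul]
    linarith

/-! ### Correlation with an integrable kernel -/

/-- The correlation `y ↦ ∫ E(z) ψ(y + z) dz`. -/
noncomputable def correlation (E ψ : ℝ × ℝ → ℝ) (y : ℝ × ℝ) : ℝ := ∫ z, E z * ψ (y + z)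

section correlation
variable {E ψ : ℝ × ℝ → ℝ}

theorem correlation_eq_convolution (E ψ : ℝ × ℝ → ℝ) :
    correlation E ψ =
      convolution (fun z => E (-z)) ψ (ContinuousLinearMap.mul ℝ ℝ) volume := by
  ext y
  rw [correlation, convolution, ← integral_neg_eq_self]
  simp [sub_eq_add_neg]

theorem contDiff_correlation (hE : Integrable E) (hψ : ContDiff ℝ ∞ ψ)
    (hc : HasCompactSupport ψ) : ContDiff ℝ ∞ (correlation E ψ) := by
  rw [correlation_eq_convolution]
  exact hc.contDiff_convolution_right (n := ⊤) _ hE.comp_neg.locallyIntegrable hψ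

theorem dirDeriv_correlation (hE : Integrable E) (hψ : ContDiff ℝ ∞ ψ)
    (hc : HasCompactSupport ψ) (d : ℝ × ℝ) :
    dirDeriv d (correlation E ψ) = correlation E (dirDeriv d ψ) := by
  ext y
  have h := hc.hasFDerivAt_convolution_right (ContinuousLinearMap.mul ℝ ℝ)
    hE.comp_neg.locallyIntegrable (hψ.of_le (by simp)) y
  rw [dirDeriv, correlation_eq_convolution, correlation_eq_convolution, h.fderiv,
    convolution_precompR_apply _ hE.comp_neg.locallyIntegrable (hc.fderiv ℝ)
      (hψ.continuous_fderiv (by simp))]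
  rfl

theorem backwardHeat_correlation (hE : Integrable E) (hψ : ContDiff ℝ ∞ ψ)
    (hc : HasCompactSupport ψ) :
    backwardHeat (correlation E ψ) = correlation E (backwardHeat ψ) := by
  have hψt := contDiff_dirDeriv (d := (0, 1)) hψ
  have hct := hasCompactSupport_dirDeriv (d := (0, 1)) hc
  have i : ∀ {g : ℝ × ℝ → ℝ} (y : ℝ × ℝ), ContDiff ℝ ∞ g → HasCompactSupport g →
      Integrable (fun z => E z * g (y + z)) := by
    intro g y hg hgc
    obtain ⟨C, _, hC⟩ := exists_bound_of_hasCompactSupport hg.continuous hgc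
    exact hE.mul_bdd (hg.continuous.comp (by fun_prop)).aestronglyMeasurable
      (ae_of_all _ fun z => hC _)
  ext y
  rw [backwardHeat, dirDeriv_correlation hE hψ hc, dirDeriv_correlation hE hψ hc,
    dirDeriv_correlation hE hψt hct]
  simp only [correlation]
  rw [← integral_add (i y (contDiff_dirDeriv hψ) (hasCompactSupport_dirDeriv hc))
    (i y (contDiff_dirDeriv hψt) (hasCompactSupport_dirDeriv hct))]
  simp only [backwardHeat, mul_add]

/-- A nonzero integrand at y forces `y = x - z` with x in the support of ψ and z in K; the set of
such differences is compact, hence closed. With K in `s ≥ 0`, supports move only backwards in `s`.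
-/
theorem tsupport_correlation_subset {K : Set (ℝ × ℝ)} (hK : IsCompact K)
    (hE : ∀ p, E p ≠ 0 → p ∈ K) (hc : HasCompactSupport ψ) :
    HasCompactSupport (correlation E ψ) ∧
      ∀ y ∈ tsupport (correlation E ψ), ∃ x ∈ tsupport ψ, ∃ z ∈ K, x - z = y := by
  have hS : IsCompact (image2 (fun x z => x - z) (tsupport ψ) K) := by
    rw [← image_uncurry_prod]
    exact (IsCompact.prod hc hK).image continuous_sub
  have hsub : Function.support (correlation E ψ) ⊆ image2 (fun x z => x - z) (tsupport ψ) K := by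
    intro y hy
    obtain ⟨z, hz⟩ : ∃ z, E z * ψ (y + z) ≠ 0 := by
      by_contra! h
      exact hy (by simp [correlation, h])
    exact ⟨y + z, subset_tsupport _ (right_ne_zero_of_mul hz), z, hE z (left_ne_zero_of_mul hz),
      by simp⟩
  have hsub' := closure_minimal hsub hS.isClosed
  exact ⟨HasCompactSupport.of_support_subset_isCompact hS hsub, fun y hy => hsub' hy⟩

theorem integral_mul_correlation {f R : ℝ × ℝ → ℝ} (hf : Integrable f) (hR : Continuous R)
    (hRc : HasCompactSupport R) (hψ : Continuous ψ) (hc : HasCompactSupport ψ) :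
    ∫ y, f y * correlation R ψ y =
      ∫ x, ψ x * convolution f R (ContinuousLinearMap.mul ℝ ℝ) volume x := by
  obtain ⟨C, _, hC⟩ := exists_bound_of_hasCompactSupport hR hRc
  have h1 : Integrable (Function.uncurry fun y x => f y * (R (x - y) * ψ x))
      ((volume : Measure (ℝ × ℝ)).prod volume) := by
    have hψi : Integrable ψ := hψ.integrable_of_hasCompactSupport hc
    have h2 := (hf.mul_prod hψi).mul_bdd (c := C)
      (g := fun q : (ℝ × ℝ) × (ℝ × ℝ) => R (q.2 - q.1))
      (hR.comp (by fun_prop)).aestronglyMeasurable (ae_of_all _ fun z => hC _)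
    refine h2.congr (ae_of_all _ fun q => ?_)
    simp only [Function.uncurry]
    ring
  calc ∫ y, f y * correlation R ψ y
      = ∫ y, ∫ x, f y * (R (x - y) * ψ x) := by
        refine integral_congr_ae (ae_of_all _ fun y => ?_)
        simp only [correlation]
        rw [integral_const_mul, ← integral_sub_right_eq_self _ y]
        simp
    _ = ∫ x, ∫ y, f y * (R (x - y) * ψ x) := integral_integral_swap h1
    _ = _ := by
        refine integral_congr_ae (ae_of_all _ fun x => ?_)
        simp only [convolution, ContinuousLinearMap.mul_apply']
        rw [← integral_const_mul]
        exact integral_congr_ae (ae_of_all _ fun y => by ring)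

end correlation

/-! ### The boundary line and one-sided derivatives -/

/-- The open lower half plane. -/
def openLowerHalfPlane : Set (ℝ × ℝ) := {p | p.1 < 0}

theorem isOpen_openLowerHalfPlane : IsOpen openLowerHalfPlane :=
  isOpen_lt continuous_fst continuous_const

theorem isClosed_lowerHalfPlane : IsClosed lowerHalfPlane :=
  isClosed_le continuous_fst continuous_const

theorem lowerHalfPlane_subset_closure : lowerHalfPlane ⊆ closure openLowerHalfPlane := by
  have : openLowerHalfPlane = Iio (0 : ℝ) ×ˢ univ := by ext; simp [openLowerHalfPlane]
  rw [this, closure_prod_eq, closure_Iio]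
  intro p hp
  exact ⟨hp, by simp⟩

theorem ae_fst_ne_zero : ∀ᵐ p : ℝ × ℝ, p.1 ≠ 0 := by
  have h : ∀ᵐ s : ℝ, s ≠ 0 := by simp [ae_iff, measure_singleton]
  exact Measure.quasiMeasurePreserving_fst.ae h

/-- Continuous functions equal almost everywhere on an open set are equal there, and points with `s
= 0` are limits of points with `s < 0`. -/
theorem eqOn_inter_lowerHalfPlane_of_ae_eq {f g : ℝ × ℝ → ℝ} (hf : Continuous f)
    (hg : Continuous g) {V : Set (ℝ × ℝ)} (hV : IsOpen V)
    (h : ∀ᵐ p, p ∈ V ∩ openLowerHalfPlane → f p = g p) : EqOn f g (V ∩ lowerHalfPlane) := by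
  have hO : IsOpen (V ∩ openLowerHalfPlane) := hV.inter isOpen_openLowerHalfPlane
  have h1 : EqOn f g (V ∩ openLowerHalfPlane) :=
    Measure.eqOn_open_of_ae_eq ((ae_restrict_iff' hO.measurableSet).2 h) hO hf.continuousOn
      hg.continuousOn
  intro p hp
  exact h1.closure hf hg (hV.inter_closure ⟨hp.1, lowerHalfPlane_subset_closure hp.2⟩)

theorem partialS_univ (f : ℝ × ℝ → ℝ) (hf : ContDiff ℝ ∞ f) :
    partialS univ f = dirDeriv (1, 0) f := by
  ext p
  have h : HasDerivAt (fun σ : ℝ => (σ, p.2)) ((1, 0) : ℝ × ℝ) p.1 :=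
    (hasDerivAt_id p.1).prodMk (hasDerivAt_const p.1 p.2)
  simpa [partialS, ofPred_true] using (hasDerivAt_dirDeriv hf h).deriv

theorem partialT_univ (f : ℝ × ℝ → ℝ) (hf : ContDiff ℝ ∞ f) :
    partialT univ f = dirDeriv (0, 1) f := by
  ext p
  have h : HasDerivAt (fun τ : ℝ => (p.1, τ)) ((0, 1) : ℝ × ℝ) p.2 :=
    (hasDerivAt_const p.2 p.1).prodMk (hasDerivAt_id p.2)
  simpa [partialT, ofPred_true] using (hasDerivAt_dirDeriv hf h).deriv

/-- The horizontal slice of Ω is locally a piece of `Iic 0`, where derivatives are unique even at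
the endpoint. So the one-sided derivative is that of the smooth extension w. -/
theorem partialS_eq_dirDeriv {Ω : Set (ℝ × ℝ)} (hΩ : IsOpenInLowerHalfPlane Ω)
    {v w : ℝ × ℝ → ℝ} (hw : ContDiff ℝ ∞ w) {p : ℝ × ℝ} (hp : p ∈ Ω) (h : v =ᶠ[𝓝[Ω] p] w) :
    partialS Ω v p = dirDeriv (1, 0) w p := by
  obtain ⟨U, hU, rfl⟩ := hΩ
  have hcurve : HasDerivAt (fun σ : ℝ => (σ, p.2)) ((1, 0) : ℝ × ℝ) p.1 :=
    (hasDerivAt_id p.1).prodMk (hasDerivAt_const p.1 p.2)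
  have hcont : Continuous (fun σ : ℝ => (σ, p.2)) := by fun_prop
  have hslice : {σ : ℝ | (σ, p.2) ∈ lowerHalfPlane ∩ U} = Iic 0 ∩ {σ : ℝ | (σ, p.2) ∈ U} := by
    ext; simp [lowerHalfPlane]
  have hev : (fun σ : ℝ => v (σ, p.2)) =ᶠ[𝓝[{σ : ℝ | (σ, p.2) ∈ lowerHalfPlane ∩ U}] p.1]
      fun σ => w (σ, p.2) :=
    (tendsto_nhdsWithin_iff.2 ⟨(hcont.tendsto p.1).mono_left inf_le_left,
      eventually_mem_nhdsWithin⟩ : Tendsto (fun σ : ℝ => (σ, p.2)) _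
        (𝓝[lowerHalfPlane ∩ U] p)).eventually h
  rw [partialS, hev.derivWithin_eq (h.self_of_nhdsWithin hp)]
  refine ((hasDerivAt_dirDeriv hw hcurve).hasDerivWithinAt).derivWithin ?_
  rw [hslice]
  exact (uniqueDiffOn_Iic 0 p.1 hp.1).inter ((hU.preimage hcont).mem_nhds hp.2)

theorem partialT_eq_dirDeriv {Ω : Set (ℝ × ℝ)} (hΩ : IsOpenInLowerHalfPlane Ω)
    {v w : ℝ × ℝ → ℝ} (hw : ContDiff ℝ ∞ w) {p : ℝ × ℝ} (hp : p ∈ Ω) (h : v =ᶠ[𝓝[Ω] p] w) :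
    partialT Ω v p = dirDeriv (0, 1) w p := by
  obtain ⟨U, hU, rfl⟩ := hΩ
  have hcurve : HasDerivAt (fun τ : ℝ => (p.1, τ)) ((0, 1) : ℝ × ℝ) p.2 :=
    (hasDerivAt_const p.2 p.1).prodMk (hasDerivAt_id p.2)
  have hcont : Continuous (fun τ : ℝ => (p.1, τ)) := by fun_prop
  have hp1 : p.1 ≤ 0 := hp.1
  have hslice : {τ : ℝ | (p.1, τ) ∈ lowerHalfPlane ∩ U} = {τ : ℝ | (p.1, τ) ∈ U} := by
    ext; simp [lowerHalfPlane, hp1]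
  have hev : (fun τ : ℝ => v (p.1, τ)) =ᶠ[𝓝[{τ : ℝ | (p.1, τ) ∈ lowerHalfPlane ∩ U}] p.2]
      fun τ => w (p.1, τ) :=
    (tendsto_nhdsWithin_iff.2 ⟨(hcont.tendsto p.2).mono_left inf_le_left,
      eventually_mem_nhdsWithin⟩ : Tendsto (fun τ : ℝ => (p.1, τ)) _
        (𝓝[lowerHalfPlane ∩ U] p)).eventually h
  rw [partialT, hev.derivWithin_eq (h.self_of_nhdsWithin hp)]
  refine ((hasDerivAt_dirDeriv hw hcurve).hasDerivWithinAt).derivWithin ?_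
  rw [hslice]
  exact (hU.preimage hcont).uniqueDiffWithinAt hp.2

/-! ### Local regularity of weak solutions -/

/-- Weak solutions in `Ω` of the heat equation. -/
def IsWeakSolution (Ω : Set (ℝ × ℝ)) (u : ℝ × ℝ → ℝ) : Prop :=
  ∀ φ : ℝ × ℝ → ℝ, IsTestFunction (interior Ω) φ → ∫ p in Ω, u p * backwardHeat φ p = 0

theorem inter_openLowerHalfPlane_subset_interior {Ω V : Set (ℝ × ℝ)} (hV : IsOpen V)
    (h : V ∩ lowerHalfPlane ⊆ Ω) : V ∩ openLowerHalfPlane ⊆ interior Ω :=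
  interior_maximal (fun p hp => h ⟨hp.1, le_of_lt (show p.1 < 0 from hp.2)⟩)
    (hV.inter isOpen_openLowerHalfPlane)

/-- A weak solution agrees almost everywhere near a point with a smooth function. -/
theorem IsWeakSolution.exists_contDiff_ae_eq {Ω : Set (ℝ × ℝ)} (hΩm : MeasurableSet Ω)
    {u : ℝ × ℝ → ℝ} (hweak : IsWeakSolution Ω u) {p : ℝ × ℝ} {r : ℝ} (hr : 0 < r)
    (hsub : ball p (2 * r) ∩ lowerHalfPlane ⊆ Ω) (hu : IntegrableOn u (ball p (2 * r) ∩ Ω)) :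
    ∃ v : ℝ × ℝ → ℝ, ContDiff ℝ ∞ v ∧
      ∀ᵐ q, q ∈ ball p r ∩ openLowerHalfPlane → u q = v q := by
  obtain ⟨E, R, hE, hEs, hR, hRc, hER⟩ := exists_parametrix hr
  have hsub' : ball p (2 * r) ∩ openLowerHalfPlane ⊆ interior Ω :=
    inter_openLowerHalfPlane_subset_interior isOpen_ball hsub
  -- Radius `2r` leaves room for a test function in the ball of radius `r` to be displaced by the
  -- parametrix, whose support has radius `r`.
  obtain ⟨f, hf⟩ : ∃ f, f = (ball p (2 * r) ∩ Ω).indicator u := ⟨_, rfl⟩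
  have hfi : Integrable f :=
    hf ▸ (integrable_indicator_iff (isOpen_ball.measurableSet.inter hΩm)).2 hu
  have hv : ContDiff ℝ ∞ (convolution f R (ContinuousLinearMap.mul ℝ ℝ) volume) :=
    hRc.contDiff_convolution_right (n := ⊤) _ hfi.locallyIntegrable hR
  refine ⟨_, hv, ?_⟩
  have hO : IsOpen (ball p r ∩ openLowerHalfPlane) := isOpen_ball.inter isOpen_openLowerHalfPlane
  have key := hO.ae_eq_zero_of_integral_contDiff_smul_eq_zero (μ := volume)
    (f := fun q => f q - convolution f R (ContinuousLinearMap.mul ℝ ℝ) volume q)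
    ((hfi.locallyIntegrable.sub hv.continuous.locallyIntegrable).locallyIntegrableOn _) ?_
  · filter_upwards [key] with q hq hqO
    have h1 := hq hqO
    have h2 : q ∈ ball p (2 * r) ∩ openLowerHalfPlane :=
      ⟨ball_subset_ball (by linarith) hqO.1, hqO.2⟩
    have h3 : f q = u q := by
      rw [hf]
      exact indicator_of_mem (show q ∈ ball p (2 * r) ∩ Ω from
        ⟨h2.1, interior_subset (hsub' h2)⟩) u
    linarith
  intro ψ hψ hψc hψs
  have hK : IsCompact (closedBall (0 : ℝ × ℝ) r ∩ {p | 0 ≤ p.1}) :=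
    (isCompact_closedBall _ _).inter_right (isClosed_le continuous_const continuous_fst)
  obtain ⟨hφc, hφs⟩ := tsupport_correlation_subset hK hEs hψc
  have hφs' : tsupport (correlation E ψ) ⊆ ball p (2 * r) ∩ openLowerHalfPlane := by
    intro y hy
    obtain ⟨x, hx, z, hz, rfl⟩ := hφs y hy
    obtain ⟨hx1, hx2⟩ := hψs hx
    refine ⟨?_, ?_⟩
    · rw [mem_ball_iff_norm] at hx1 ⊢
      have hz1 := mem_closedBall_zero_iff.1 hz.1
      calc ‖x - z - p‖ = ‖(x - p) - z‖ := by congr 1; abel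
        _ ≤ ‖x - p‖ + ‖z‖ := norm_sub_le _ _
        _ < 2 * r := by linarith
    -- Causality: E lives in `s ≥ 0`, so subtracting z keeps the support in `s < 0`.
    · have hz2 : 0 ≤ z.1 := hz.2
      have hx3 : x.1 < 0 := hx2
      change x.1 - z.1 < 0
      linarith
  have hφ := contDiff_correlation hE hψ hψc
  have h0 := hweak _ ⟨hφ, hφc, hφs'.trans hsub'⟩
  have h1 : ∫ q, f q * backwardHeat (correlation E ψ) q = 0 := by
    rw [← h0, ← integral_indicator hΩm]
    refine integral_congr_ae (ae_of_all _ fun q => ?_)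
    by_cases hq : q ∈ tsupport (correlation E ψ)
    · have hq' := hφs' hq
      have hqΩ : q ∈ Ω := interior_subset (hsub' hq')
      simp [hf, hqΩ, hq'.1]
    · simp only [backwardHeat_of_notMem_tsupport hq, mul_zero]
      symm
      exact indicator_apply_eq_zero.2 fun _ => by simp [backwardHeat_of_notMem_tsupport hq]
  -- The parametrix identity applied to the translate of ψ by y.
  have h2 : backwardHeat (correlation E ψ) = fun y => -ψ y + correlation R ψ y := by
    rw [backwardHeat_correlation hE hψ hψc]
    ext y
    have h3 := hER (fun q => ψ (y + q)) (hψ.comp (contDiff_const.add contDiff_id))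
      (hψc.comp_homeomorph (Homeomorph.addLeft y))
    simpa only [backwardHeat_comp_add_left, add_zero, correlation] using h3
  obtain ⟨C, _, hC⟩ := exists_bound_of_hasCompactSupport hψ.continuous hψc
  have hRi : Integrable R := hR.continuous.integrable_of_hasCompactSupport hRc
  have hRψ := (contDiff_correlation hRi hψ hψc).continuous
  have hRψc := (tsupport_correlation_subset hRc (fun p hp => subset_tsupport _ hp) hψc).1
  obtain ⟨C', _, hC'⟩ := exists_bound_of_hasCompactSupport hRψ hRψc
  have i1 : Integrable (fun q => f q * ψ q) :=
    hfi.mul_bdd hψ.continuous.aestronglyMeasurable (ae_of_all _ hC)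
  have i2 : Integrable (fun q => f q * correlation R ψ q) :=
    hfi.mul_bdd hRψ.aestronglyMeasurable (ae_of_all _ hC')
  have i3 : Integrable (fun q =>
      ψ q * convolution f R (ContinuousLinearMap.mul ℝ ℝ) volume q) :=
    (hψ.continuous.mul hv.continuous).integrable_of_hasCompactSupport hψc.mul_right
  have i4 : Integrable (fun q => ψ q * f q) := i1.congr (ae_of_all _ fun q => mul_comm _ _)
  have h4 : ∫ q, f q * backwardHeat (correlation E ψ) q =
      -(∫ q, ψ q * f q) + ∫ q, f q * correlation R ψ q := by
    have i5 : Integrable (fun q => -(ψ q * f q)) := i4.neg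
    rw [← integral_neg, ← integral_add i5 i2]
    refine integral_congr_ae (ae_of_all _ fun q => ?_)
    simp only [h2]
    ring
  simp only [smul_eq_mul, mul_sub]
  rw [integral_sub i4 i3, ← integral_mul_correlation hfi hR.continuous hRc hψ.continuous hψc]
  linarith

/-- A smooth function that agrees with a weak solution is a classical solution. -/
theorem IsWeakSolution.heatOp_eq_zero {Ω : Set (ℝ × ℝ)} (hΩm : MeasurableSet Ω)
    {u v : ℝ × ℝ → ℝ} (hweak : IsWeakSolution Ω u) {V : Set (ℝ × ℝ)} (hV : IsOpen V)
    (hsub : V ∩ lowerHalfPlane ⊆ Ω) (hv : ContDiff ℝ ∞ v)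
    (h : ∀ᵐ q, q ∈ V ∩ openLowerHalfPlane → u q = v q) :
    ∀ q ∈ V ∩ lowerHalfPlane, heatOp v q = 0 := by
  have hsub' := inter_openLowerHalfPlane_subset_interior hV hsub
  have hH := (contDiff_heatOp hv).continuous
  -- Testing reaches only `s < 0`; continuity of `heatOp v` carries the equation to the boundary.
  refine eqOn_inter_lowerHalfPlane_of_ae_eq hH (continuous_const (y := (0 : ℝ))) hV ?_
  refine (hV.inter isOpen_openLowerHalfPlane).ae_eq_zero_of_integral_contDiff_smul_eq_zero
    (hH.locallyIntegrable.locallyIntegrableOn _) fun φ hφ hφc hφs => ?_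
  have h0 := hweak φ ⟨hφ, hφc, hφs.trans hsub'⟩
  have h1 : ∫ q, v q * backwardHeat φ q = 0 := by
    rw [← h0, ← integral_indicator hΩm]
    refine integral_congr_ae ?_
    filter_upwards [h] with q hq
    by_cases hqφ : q ∈ tsupport φ
    · have hq' := hφs hqφ
      have hqΩ : q ∈ Ω := interior_subset (hsub' hq')
      simp [hqΩ, hq hq']
    · rw [backwardHeat_of_notMem_tsupport hqφ, mul_zero, eq_comm]
      exact indicator_apply_eq_zero.2 fun _ => by simp [backwardHeat_of_notMem_tsupport hqφ]
  rw [integral_mul_backwardHeat hv hφ hφc, neg_eq_zero] at h1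
  rw [← h1]
  exact integral_congr_ae (ae_of_all _ fun q => by simp [mul_comm])

theorem IsWeakSolution.exists_local_representative {Ω : Set (ℝ × ℝ)}
    (hΩ : IsOpenInLowerHalfPlane Ω) {u : ℝ × ℝ → ℝ} (hu : LocallyIntegrableOn u Ω volume)
    (hweak : IsWeakSolution Ω u) {p : ℝ × ℝ} (hp : p ∈ Ω) :
    ∃ V : Set (ℝ × ℝ), ∃ v : ℝ × ℝ → ℝ, IsOpen V ∧ p ∈ V ∧ ContDiff ℝ ∞ v ∧
      (∀ᵐ q, q ∈ V ∩ openLowerHalfPlane → u q = v q) ∧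
      ∀ q ∈ V ∩ lowerHalfPlane, heatOp v q = 0 := by
  obtain ⟨U, hU, rfl⟩ := hΩ
  have hΩm : MeasurableSet (lowerHalfPlane ∩ U) :=
    isClosed_lowerHalfPlane.measurableSet.inter hU.measurableSet
  obtain ⟨s, hs, hus⟩ := hu p hp
  obtain ⟨W, hW, hpW, hWs⟩ := mem_nhdsWithin.1 hs
  obtain ⟨ε, hε, hball⟩ := Metric.isOpen_iff.1 (hW.inter hU) p ⟨hpW, hp.2⟩
  have hε' : 2 * (ε / 2) = ε := by ring
  have hsub : ball p (2 * (ε / 2)) ∩ lowerHalfPlane ⊆ lowerHalfPlane ∩ U := by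
    rw [hε']
    exact fun q hq => ⟨hq.2, (hball hq.1).2⟩
  obtain ⟨v, hv, huv⟩ := hweak.exists_contDiff_ae_eq hΩm (half_pos hε) hsub
    (hus.mono_set (by rw [hε']; exact fun q hq => hWs ⟨(hball hq.1).1, hq.2⟩))
  refine ⟨_, v, isOpen_ball, mem_ball_self (half_pos hε), hv, huv, ?_⟩
  exact hweak.heatOp_eq_zero hΩm isOpen_ball
    ((inter_subset_inter_left _ (ball_subset_ball (by linarith))).trans hsub) hv huv

end ParabolicWeyl

/-! ### Gluing the local representatives -/

open ParabolicWeyl Filter Topology in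
theorem mainTheorem2 (Ω : Set (ℝ × ℝ)) (hΩ : IsOpenInLowerHalfPlane Ω)
    (u : ℝ × ℝ → ℝ) (hu : LocallyIntegrableOn u Ω volume)
    (hweak : ∀ φ : ℝ × ℝ → ℝ, IsTestFunction (interior Ω) φ →
      ∫ p in Ω, u p * (-partialS univ φ p - partialT univ (partialT univ φ) p) = 0) :
    ∃ v : ℝ × ℝ → ℝ,
      u =ᵐ[volume.restrict Ω] v ∧
      ContDiffOn ℝ ∞ v Ω ∧
      ∀ p ∈ Ω, partialS Ω v p - partialT Ω (partialT Ω v) p = 0 := by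
  have hw : IsWeakSolution Ω u := by
    intro φ hφ
    rw [← neg_eq_zero, ← integral_neg, ← hweak φ hφ]
    refine integral_congr_ae (ae_of_all _ fun p => ?_)
    simp only [partialS_univ φ hφ.smooth, partialT_univ φ hφ.smooth,
      partialT_univ _ (contDiff_dirDeriv hφ.smooth), backwardHeat]
    ring
  have hloc := fun p (hp : p ∈ Ω) => hw.exists_local_representative hΩ hu hp
  choose! V w hVo hpV hwc huw hheat using hloc
  have hΩm : MeasurableSet Ω := by
    obtain ⟨U, hU, rfl⟩ := hΩ
    exact isClosed_lowerHalfPlane.measurableSet.inter hU.measurableSet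
  have hΩs : Ω ⊆ lowerHalfPlane := by
    obtain ⟨U, hU, rfl⟩ := hΩ
    exact inter_subset_left
  -- The glued function takes at q the value of q's own representative. On overlaps both
  -- representatives equal u almost everywhere in `s < 0`, hence agree up to the boundary.
  have heq : ∀ p ∈ Ω, ∀ q ∈ V p ∩ Ω, w q q = w p q := by
    intro p hp q hq
    refine eqOn_inter_lowerHalfPlane_of_ae_eq (hwc q hq.2).continuous (hwc p hp).continuous
      ((hVo q hq.2).inter (hVo p hp)) ?_ ⟨⟨hpV q hq.2, hq.1⟩, hΩs hq.2⟩
    filter_upwards [huw p hp, huw q hq.2] with x h1 h2 hx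
    rw [← h1 ⟨hx.1.2, hx.2⟩, h2 ⟨hx.1.1, hx.2⟩]
  have hev : ∀ p ∈ Ω, (fun q => w q q) =ᶠ[𝓝[Ω] p] w p := fun p hp =>
    mem_nhdsWithin.2 ⟨V p, hVo p hp, hpV p hp, fun q hq => heq p hp q hq⟩
  refine ⟨fun q => w q q, ?_, ?_, ?_⟩
  · rw [EventuallyEq, ae_restrict_iff' hΩm, ae_iff]
    refine measure_null_of_locally_null _ fun p hp => ?_
    obtain ⟨hpΩ, -⟩ := Classical.not_imp.1 hp
    refine ⟨_, inter_mem_nhdsWithin _ ((hVo p hpΩ).mem_nhds (hpV p hpΩ)), ?_⟩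
    refine measure_eq_zero_iff_ae_notMem.2 ?_
    -- Nothing is known about u on `s = 0`, but that line is null.
    filter_upwards [huw p hpΩ, ae_fst_ne_zero] with q hq hq0 hmem
    obtain ⟨hqΩ, hne⟩ := Classical.not_imp.1 hmem.1
    refine hne ?_
    rw [heq p hpΩ q ⟨hmem.2, hqΩ⟩]
    exact hq ⟨hmem.2, lt_of_le_of_ne (hΩs hqΩ) hq0⟩
  · exact fun p hp => (hwc p hp).contDiffAt.contDiffWithinAt.congr_of_eventuallyEq (hev p hp) rfl
  · intro p hp
    -- The second derivative needs the first one on a neighbourhood of p in Ω, not only at p.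
    have hT : partialT Ω (fun q => w q q) =ᶠ[𝓝[Ω] p] dirDeriv (0, 1) (w p) := by
      refine mem_nhdsWithin.2 ⟨V p, hVo p hp, hpV p hp, fun q hq => ?_⟩
      refine partialT_eq_dirDeriv hΩ (hwc p hp) hq.2 ?_
      exact mem_nhdsWithin.2 ⟨V p, hVo p hp, hq.1, fun x hx => heq p hp x hx⟩
    rw [partialS_eq_dirDeriv hΩ (hwc p hp) hp (hev p hp),
      partialT_eq_dirDeriv hΩ (contDiff_dirDeriv (hwc p hp)) hp hT]
    exact hheat p hp p ⟨hpV p hp, hΩs hp⟩
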